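/- Let $G=\mathfrak S_4\times\mathbb Z/2$ (the group $\langle 48,48\rangle$ of the small groups library). For a type $T=[m_1,\dots,m_r]$ with $2\le m_1\le\dots\le m_r$, let $\mathcal B(G,T)$ be the set of spherical systems of generators of $G$ of type $T$, that is, of $r$-tuples $A=(g_1,\dots,g_r)$ of elements of $G$ with $G=\langle g_1,\dots,g_r\rangle$ and $g_1\cdots g_r=1$ such that, for some permutation $\tau\in\mathfrak S_r$, $\mathrm{ord}(g_i)=m_{\tau(i)}$ for all $i$. Put $\Sigma(A)=\{hg_i^jh^{-1} : h\in G,\ j\in\mathbb Z,\ 1\le i\le r\}$, and call a pair $(A_1,A_2)$ disjoint if $\Sigma(A_1)\cap\Sigma(A_2)=\{1\}$. The Artin braid group $\boldsymbol B_r=\langle\sigma_1,\dots,\sigma_{r-1} \mid \sigma_i\sigma_j=\sigma_j\sigma_i \text{ for } |i-j|>1,\ \sigma_i\sigma_{i+1}\sigma_i=\sigma_{i+1}\sigma_i\sigma_{i+1}\rangle$ acts on $\mathcal B(G,T)$ by $$\sigma_i(g_1,\dots,g_r)=(g_1,\dots,g_{i-1},\,g_ig_{i+1}g_i^{-1},\,g_i,\,g_{i+2},\dots,g_r),$$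 and $\mathrm{Aut}(G)$ acts entrywise. For types $T_1,T_2$ of lengths $r,s$, the group $\boldsymbol B_r\times\boldsymbol B_s\times\mathrm{Aut}(G)$ acts on $\mathcal B(G,T_1)\times\mathcal B(G,T_2)$ by $(\gamma_1,\gamma_2,\varphi)\cdot(A_1,A_2)=(\varphi(\gamma_1(A_1)),\varphi(\gamma_2(A_2)))$, and this action preserves the set of disjoint pairs. Then, for $T_1=[2^8]=[2,2,2,2,2,2,2,2]$ and $T_2=[2,4,6]$, disjoint pairs $(A_1,A_2)\in\mathcal B(G,T_1)\times\mathcal B(G,T_2)$ exist, and the number of orbits of $\boldsymbol B_8\times\boldsymbol B_3\times\mathrm{Aut}(G)$ on the set of disjoint pairs is exactly two. -/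

import Mathlib

/-- `A = (g_1, …, g_r)` is a spherical system of generators of `G` of type `T = [m_1, …, m_r]`:
the `g_i` generate `G`, their ordered product is `1`, and up to a permutation `ord g_i = m_{τ i}`. -/
structure IsSphericalSystem {G : Type*} [Group G] {r : ℕ} (T : Fin r → ℕ) (A : Fin r → G) :
    Prop where
  generates : Subgroup.closure (Set.range A) = ⊤
  prod_eq_one : (List.ofFn A).prod = 1
  orders : ∃ τ : Equiv.Perm (Fin r), ∀ i, orderOf (A i) = T (τ i)

/-- The set `𝓑(G, T)` of spherical systems of generators of `G` of type `T`. -/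
def SphericalSystem (G : Type*) [Group G] {r : ℕ} (T : Fin r → ℕ) : Type _ :=
  {A : Fin r → G // IsSphericalSystem T A}

/-- The stabilizer set `Σ(A)`: all conjugates of all powers of the entries of `A`. -/
def stabilizerSet {G : Type*} [Group G] {r : ℕ} (A : Fin r → G) : Set G :=
  ⋃ h : G, ⋃ j : ℤ, ⋃ i : Fin r, {h * A i ^ j * h⁻¹}

/-- The defining relators of the Artin braid group on the generators `σ_i`, `i : Fin (r - 1)`
(numbered from `0`). -/
def braidRels (r : ℕ) : Set (FreeGroup (Fin (r - 1))) :=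
  {w | ∃ i j : Fin (r - 1), i.val + 1 < j.val ∧
      w = (FreeGroup.of i * FreeGroup.of j) * (FreeGroup.of j * FreeGroup.of i)⁻¹} ∪
  {w | ∃ i j : Fin (r - 1), i.val + 1 = j.val ∧
      w = (FreeGroup.of i * FreeGroup.of j * FreeGroup.of i) *
        (FreeGroup.of j * FreeGroup.of i * FreeGroup.of j)⁻¹}

/-- The Artin braid group on `r` strands. -/
abbrev BraidGroup (r : ℕ) : Type := PresentedGroup (braidRels r)

namespace Hurwitz

variable {G : Type*} [Group G] {r : ℕ}

/-- The left position moved by the generator with (zero-based) index `i`. -/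
def lo (i : Fin (r - 1)) : Fin r := ⟨i.val, by have := i.isLt; omega⟩

/-- The right position moved by the generator with (zero-based) index `i`. -/
def hi (i : Fin (r - 1)) : Fin r := ⟨i.val + 1, by have := i.isLt; omega⟩

theorem hi_ne_lo (i : Fin (r - 1)) : hi i ≠ lo i := by
  simp [hi, lo, Fin.ext_iff]

/-- The elementary move `(…, a, b, …) ↦ (…, a b a⁻¹, a, …)`. -/
def move (i : Fin (r - 1)) (A : Fin r → G) : Fin r → G := fun k =>
  if k = lo i then A (lo i) * A (hi i) * (A (lo i))⁻¹
  else if k = hi i then A (lo i)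
  else A k

/-- The inverse move `(…, a, b, …) ↦ (…, b, b⁻¹ a b, …)`. -/
def moveInv (i : Fin (r - 1)) (A : Fin r → G) : Fin r → G := fun k =>
  if k = lo i then A (hi i)
  else if k = hi i then (A (hi i))⁻¹ * A (lo i) * A (hi i)
  else A k

theorem move_lo (i : Fin (r - 1)) (A : Fin r → G) :
    move i A (lo i) = A (lo i) * A (hi i) * (A (lo i))⁻¹ := by simp [move]

theorem move_hi (i : Fin (r - 1)) (A : Fin r → G) : move i A (hi i) = A (lo i) := by
  simp [move, hi_ne_lo]

theorem move_of_ne (i : Fin (r - 1)) (A : Fin r → G) {k : Fin r} (h1 : k ≠ lo i)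
    (h2 : k ≠ hi i) : move i A k = A k := by simp [move, h1, h2]

/-- The elementary move as a permutation of the set of `r`-tuples. -/
def moveEquiv (i : Fin (r - 1)) : Equiv.Perm (Fin r → G) where
  toFun := move i
  invFun := moveInv i
  left_inv A := by
    funext k
    simp only [move, moveInv, hi_ne_lo, if_true, if_false]
    split_ifs with h1 h2
    · rw [h1]
    · rw [h2]; group
    · rfl
  right_inv A := by
    funext k
    simp only [move, moveInv, hi_ne_lo, if_true, if_false]
    split_ifs with h1 h2
    · rw [h1]; group
    · rw [h2]
    · rfl

theorem partialProd_move (i : Fin (r - 1)) (A : Fin r → G) (n : ℕ) :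
    ∀ hn : n < r + 1, n ≠ i.val + 1 →
      Fin.partialProd (move i A) ⟨n, hn⟩ = Fin.partialProd A ⟨n, hn⟩ := by
  induction n using Nat.strong_induction_on with
  | _ n ih =>
    intro hn hne
    rcases n with _ | m
    · exact (Fin.partialProd_zero _).trans (Fin.partialProd_zero _).symm
    · have hm : m < r := by omega
      have step : ∀ (B : Fin r → G) (l : ℕ) (hl : l < r),
          Fin.partialProd B ⟨l + 1, by omega⟩ =
            Fin.partialProd B ⟨l, by omega⟩ * B ⟨l, hl⟩ :=
        fun B l hl => Fin.partialProd_succ B ⟨l, hl⟩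
      by_cases h : m = i.val + 1
      · subst h
        have e1 := move_hi i A
        have e2 := move_lo i A
        have e3 := ih i.val (by omega) (by omega) (by omega)
        rw [step _ _ hm, step _ _ hm, step _ i.val (by omega), step _ i.val (by omega), e3]
        change _ * move i A (lo i) * move i A (hi i) = _ * A (lo i) * A (hi i)
        rw [e1, e2]
        group
      · have e3 := ih m (by omega) (by omega) h
        rw [step _ _ hm, step _ _ hm, e3, move_of_ne]
        · simp only [lo, ne_eq, Fin.mk.injEq]; omega
        · simp only [hi, ne_eq, Fin.mk.injEq]; omega

theorem prod_move (i : Fin (r - 1)) (A : Fin r → G) :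
    (List.ofFn (move i A)).prod = (List.ofFn A).prod := by
  have h := partialProd_move i A r (by omega) (by have := i.isLt; omega)
  have key : ∀ B : Fin r → G, Fin.partialProd B ⟨r, by omega⟩ = (List.ofFn B).prod := by
    intro B
    simp only [Fin.partialProd]
    rw [List.take_of_length_le (by simp)]
  rwa [key, key] at h

theorem closure_move (i : Fin (r - 1)) (A : Fin r → G) :
    Subgroup.closure (Set.range (move i A)) = Subgroup.closure (Set.range A) := by
  apply le_antisymm <;> rw [Subgroup.closure_le] <;> rintro _ ⟨k, rfl⟩
  · have h : ∀ l, A l ∈ Subgroup.closure (Set.range A) := fun l =>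
      Subgroup.subset_closure ⟨l, rfl⟩
    simp only [move, SetLike.mem_coe]
    split_ifs
    · exact mul_mem (mul_mem (h _) (h _)) (inv_mem (h _))
    · exact h _
    · exact h _
  · have h : ∀ l, move i A l ∈ Subgroup.closure (Set.range (move i A)) := fun l =>
      Subgroup.subset_closure ⟨l, rfl⟩
    rw [SetLike.mem_coe]
    by_cases h1 : k = lo i
    · rw [h1, ← move_hi i A]; exact h _
    · by_cases h2 : k = hi i
      · have e : A k = (move i A (hi i))⁻¹ * move i A (lo i) * move i A (hi i) := by
          rw [move_hi, move_lo, h2]; group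
        rw [e]
        exact mul_mem (mul_mem (inv_mem (h _)) (h _)) (h _)
      · rw [← move_of_ne i A h1 h2]; exact h _

theorem isConj_move (i : Fin (r - 1)) (A : Fin r → G) (k : Fin r) :
    IsConj (A (Equiv.swap (lo i) (hi i) k)) (move i A k) := by
  by_cases h1 : k = lo i
  · rw [h1, Equiv.swap_apply_left, move_lo, isConj_iff]; exact ⟨_, rfl⟩
  · by_cases h2 : k = hi i
    · rw [h2, Equiv.swap_apply_right, move_hi]
    · rw [Equiv.swap_apply_of_ne_of_ne h1 h2, move_of_ne i A h1 h2]

theorem orderOf_move (i : Fin (r - 1)) (A : Fin r → G) (k : Fin r) :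
    orderOf (move i A k) = orderOf (A (Equiv.swap (lo i) (hi i) k)) := by
  obtain ⟨c, hc⟩ := isConj_iff.mp (isConj_move i A k)
  rw [← hc, ← MulAut.conj_apply]
  exact MulEquiv.orderOf_eq (MulAut.conj c) _

theorem isSphericalSystem_move_iff (T : Fin r → ℕ) (i : Fin (r - 1)) (A : Fin r → G) :
    IsSphericalSystem T A ↔ IsSphericalSystem T (moveEquiv i A) := by
  change IsSphericalSystem T A ↔ IsSphericalSystem T (move i A)
  constructor
  · rintro ⟨h1, h2, τ, h3⟩
    refine ⟨by rw [closure_move, h1], by rw [prod_move, h2], (Equiv.swap (lo i) (hi i)).trans τ, ?_⟩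
    intro k
    rw [orderOf_move, h3]; rfl
  · rintro ⟨h1, h2, τ, h3⟩
    refine ⟨by rw [← closure_move i, h1], by rw [← prod_move i, h2],
      (Equiv.swap (lo i) (hi i)).trans τ, ?_⟩
    intro k
    have := h3 (Equiv.swap (lo i) (hi i) k)
    rw [orderOf_move, Equiv.swap_apply_self] at this
    rw [this]; rfl

theorem moveEquiv_comm {i j : Fin (r - 1)} (h : i.val + 1 < j.val) :
    (moveEquiv i * moveEquiv j : Equiv.Perm (Fin r → G)) = moveEquiv j * moveEquiv i := by
  have a1 : lo i ≠ lo j := by simp only [lo, ne_eq, Fin.mk.injEq]; omega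
  have a2 : lo i ≠ hi j := by simp only [lo, hi, ne_eq, Fin.mk.injEq]; omega
  have a3 : hi i ≠ lo j := by simp only [lo, hi, ne_eq, Fin.mk.injEq]; omega
  have a4 : hi i ≠ hi j := by simp only [hi, ne_eq, Fin.mk.injEq]; omega
  ext A k
  change move i (move j A) k = move j (move i A) k
  by_cases h1 : k = lo i
  · subst h1; simp [move, a1, a2, a3, a4]
  by_cases h2 : k = hi i
  · subst h2; simp [move, hi_ne_lo, a1, a2, a3, a4]
  by_cases h3 : k = lo j
  · subst h3; simp [move, a1.symm, a2.symm, a3.symm, a4.symm]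
  by_cases h4 : k = hi j
  · subst h4; simp [move, hi_ne_lo, a1.symm, a2.symm, a3.symm, a4.symm]
  simp [move, h1, h2, h3, h4]

theorem moveEquiv_braid {i j : Fin (r - 1)} (h : i.val + 1 = j.val) :
    (moveEquiv i * moveEquiv j * moveEquiv i : Equiv.Perm (Fin r → G)) =
      moveEquiv j * moveEquiv i * moveEquiv j := by
  have a1 : lo j = hi i := by simp only [lo, hi, Fin.mk.injEq]; omega
  have a2 : hi j ≠ lo i := by simp only [lo, hi, ne_eq, Fin.mk.injEq]; omega
  have a3 : hi j ≠ hi i := by simp only [hi, ne_eq, Fin.mk.injEq]; omega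
  have a4 := hi_ne_lo i
  ext A k
  change move i (move j (move i A)) k = move j (move i (move j A)) k
  by_cases h1 : k = lo i
  · subst h1; simp [move, a1, a2, a3, a4, a4.symm, a2.symm, mul_assoc]
  by_cases h2 : k = hi i
  · subst h2; simp [move, a1, a2, a3, a4, a4.symm, a2.symm, mul_assoc]
  by_cases h3 : k = hi j
  · subst h3; simp [move, a1, a2, a3, a4, a4.symm, a2.symm]
  simp [move, a1, h1, h2, h3]

/-- The elementary move `σ_i` as a permutation of `𝓑(G, T)`. -/
def sigma (T : Fin r → ℕ) (i : Fin (r - 1)) : Equiv.Perm (SphericalSystem G T) :=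
  (moveEquiv i).subtypeEquiv (isSphericalSystem_move_iff T i)

theorem sigma_rels (T : Fin r → ℕ) :
    ∀ w ∈ braidRels r, FreeGroup.lift (sigma (G := G) T) w = 1 := by
  rintro w (⟨i, j, h, rfl⟩ | ⟨i, j, h, rfl⟩)
  · simp only [map_mul, map_inv, FreeGroup.lift_apply_of, mul_inv_eq_one]
    ext A : 1
    exact Subtype.ext (Equiv.congr_fun (moveEquiv_comm h) A.1)
  · simp only [map_mul, map_inv, FreeGroup.lift_apply_of, mul_inv_eq_one]
    ext A : 1
    exact Subtype.ext (Equiv.congr_fun (moveEquiv_braid h) A.1)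

/-- The Hurwitz action as a homomorphism to permutations, `σ_i ↦ sigma T i`. -/
def hom (T : Fin r → ℕ) : BraidGroup r →* Equiv.Perm (SphericalSystem G T) :=
  PresentedGroup.toGroup (sigma_rels T)

theorem hom_of (T : Fin r → ℕ) (i : Fin (r - 1)) :
    hom (G := G) T (PresentedGroup.of i) = sigma T i :=
  PresentedGroup.toGroup.of (sigma_rels T)

end Hurwitz

/-- The Hurwitz action of the braid group on `𝓑(G, T)`. -/
instance hurwitzAction {G : Type*} [Group G] {r : ℕ} (T : Fin r → ℕ) :
    MulAction (BraidGroup r) (SphericalSystem G T) where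
  smul γ A := Hurwitz.hom T γ A
  one_smul A := by
    change Hurwitz.hom T 1 A = A
    rw [map_one]; rfl
  mul_smul γ δ A := by
    change Hurwitz.hom T (γ * δ) A = Hurwitz.hom T γ (Hurwitz.hom T δ A)
    rw [map_mul]; rfl

theorem IsSphericalSystem.map {G : Type*} [Group G] {r : ℕ} {T : Fin r → ℕ} {A : Fin r → G}
    (h : IsSphericalSystem T A) (φ : MulAut G) : IsSphericalSystem T (fun i => φ (A i)) := by
  obtain ⟨h1, h2, τ, h3⟩ := h
  refine ⟨?_, ?_, τ, fun i => (MulEquiv.orderOf_eq φ (A i)).trans (h3 i)⟩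
  · have e : Set.range (fun i => φ (A i)) = φ.toMonoidHom '' Set.range A := by
      rw [← Set.range_comp]; rfl
    rw [e, ← MonoidHom.map_closure, h1]
    exact Subgroup.map_top_of_surjective _ φ.surjective
  · have e : List.ofFn (fun i => φ (A i)) = (List.ofFn A).map φ := by
      rw [List.map_ofFn]; rfl
    rw [e, ← map_list_prod, h2, map_one]

/-- The action of `Aut(G)` on `𝓑(G, T)`, entry by entry. -/
instance autAction {G : Type*} [Group G] {r : ℕ} (T : Fin r → ℕ) :
    MulAction (MulAut G) (SphericalSystem G T) where
  smul φ A := ⟨fun i => φ (A.1 i), A.2.map φ⟩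
  one_smul _ := rfl
  mul_smul _ _ _ := rfl

/-- Induction on braids acting on a set: a property of permutations closed under composition and
inverses that holds for the generators holds for all braids. -/
theorem Hurwitz.hom_induction {G : Type*} [Group G] {r : ℕ} (T : Fin r → ℕ)
    (H : Subgroup (Equiv.Perm (SphericalSystem G T))) (h : ∀ i, Hurwitz.sigma T i ∈ H)
    (γ : BraidGroup r) : Hurwitz.hom T γ ∈ H := by
  have := PresentedGroup.generated_by (braidRels r) (H.comap (Hurwitz.hom T))
    (fun i => by rw [Subgroup.mem_comap, Hurwitz.hom_of]; exact h i) γ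
  exact this

theorem aut_smul_braid_smul {G : Type*} [Group G] {r : ℕ} {T : Fin r → ℕ} (φ : MulAut G)
    (γ : BraidGroup r) (A : SphericalSystem G T) : φ • γ • A = γ • φ • A := by
  have h := Hurwitz.hom_induction T
    (Subgroup.centralizer {MulAction.toPermHom (MulAut G) (SphericalSystem G T) φ}) (by
      intro i
      rw [Subgroup.mem_centralizer_singleton_iff]
      ext B : 1
      apply Subtype.ext
      funext k
      change Hurwitz.move i (fun l => φ (B.1 l)) k = φ (Hurwitz.move i B.1 k)
      simp only [Hurwitz.move]
      split_ifs <;> simp) γ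
  rw [Subgroup.mem_centralizer_singleton_iff] at h
  exact (Equiv.congr_fun h A).symm

theorem mem_stabilizerSet {G : Type*} [Group G] {r : ℕ} {A : Fin r → G} {x : G} :
    x ∈ stabilizerSet A ↔ ∃ (h : G) (j : ℤ) (i : Fin r), x = h * A i ^ j * h⁻¹ := by
  simp only [stabilizerSet, Set.mem_iUnion, Set.mem_singleton_iff]

theorem stabilizerSet_aut_smul {G : Type*} [Group G] {r : ℕ} {T : Fin r → ℕ} (φ : MulAut G)
    (A : SphericalSystem G T) : stabilizerSet (φ • A).1 = φ '' stabilizerSet A.1 := by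
  ext x
  rw [Set.mem_image, mem_stabilizerSet]
  constructor
  · rintro ⟨h, j, i, rfl⟩
    refine ⟨φ.symm h * A.1 i ^ j * (φ.symm h)⁻¹, mem_stabilizerSet.mpr ⟨_, j, i, rfl⟩, ?_⟩
    rw [map_mul, map_mul, map_inv, map_zpow, MulEquiv.apply_symm_apply]; rfl
  · rintro ⟨y, hy, rfl⟩
    obtain ⟨h, j, i, rfl⟩ := mem_stabilizerSet.mp hy
    refine ⟨φ h, j, i, ?_⟩
    rw [map_mul, map_mul, map_inv, map_zpow]; rfl

theorem stabilizerSet_subset_of_isConj {G : Type*} [Group G] {r : ℕ} {A B : Fin r → G}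
    (s : Fin r → Fin r) (h : ∀ k, IsConj (B (s k)) (A k)) :
    stabilizerSet A ⊆ stabilizerSet B := by
  intro x hx
  obtain ⟨g, j, k, rfl⟩ := mem_stabilizerSet.mp hx
  obtain ⟨c, hc⟩ := isConj_iff.mp (h k)
  refine mem_stabilizerSet.mpr ⟨g * c, j, s k, ?_⟩
  rw [← hc, conj_zpow]; group

theorem stabilizerSet_braid_smul {G : Type*} [Group G] {r : ℕ} {T : Fin r → ℕ}
    (γ : BraidGroup r) (A : SphericalSystem G T) :
    stabilizerSet (γ • A).1 = stabilizerSet A.1 := by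
  let H : Subgroup (Equiv.Perm (SphericalSystem G T)) :=
    { carrier := {p | ∀ B, stabilizerSet (p B).1 = stabilizerSet B.1}
      mul_mem' := fun {p q} hp hq B => (hp (q B)).trans (hq B)
      one_mem' := fun B => rfl
      inv_mem' := fun {p} hp B => by
        have := hp (p⁻¹ B)
        have e : p (p⁻¹ B) = B := p.apply_symm_apply B
        rw [e] at this
        exact this.symm }
  refine Hurwitz.hom_induction T H (fun i B => ?_) γ A
  change stabilizerSet (Hurwitz.move i B.1) = stabilizerSet B.1
  apply Set.Subset.antisymm
  · exact stabilizerSet_subset_of_isConj _ (Hurwitz.isConj_move i B.1)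
  · refine stabilizerSet_subset_of_isConj (Equiv.swap (Hurwitz.lo i) (Hurwitz.hi i)) fun k => ?_
    have := Hurwitz.isConj_move i B.1 (Equiv.swap (Hurwitz.lo i) (Hurwitz.hi i) k)
    rw [Equiv.swap_apply_self] at this
    exact this.symm

/-- The disjoint pairs of spherical systems of generators of `G` of type `(T₁, T₂)`:
the two stabilizer sets meet exactly in the identity. -/
def DisjointPair (G : Type*) [Group G] {r s : ℕ} (T₁ : Fin r → ℕ) (T₂ : Fin s → ℕ) : Type _ :=
  {p : SphericalSystem G T₁ × SphericalSystem G T₂ //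
    stabilizerSet p.1.1 ∩ stabilizerSet p.2.1 = {1}}

theorem disjoint_smul {G : Type*} [Group G] {r s : ℕ} {T₁ : Fin r → ℕ} {T₂ : Fin s → ℕ}
    (γ₁ : BraidGroup r) (γ₂ : BraidGroup s) (φ : MulAut G)
    (A₁ : SphericalSystem G T₁) (A₂ : SphericalSystem G T₂)
    (h : stabilizerSet A₁.1 ∩ stabilizerSet A₂.1 = {1}) :
    stabilizerSet (φ • γ₁ • A₁).1 ∩ stabilizerSet (φ • γ₂ • A₂).1 = {1} := by
  rw [stabilizerSet_aut_smul, stabilizerSet_aut_smul, stabilizerSet_braid_smul,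
    stabilizerSet_braid_smul, ← Set.image_inter φ.injective, h, Set.image_singleton, map_one]

/-- The action of `B_r × B_s × Aut(G)` on pairs,
`(γ₁, γ₂, φ) • (A₁, A₂) = (φ(γ₁(A₁)), φ(γ₂(A₂)))`, on the (invariant) set of disjoint pairs. -/
instance combinedAction {G : Type*} [Group G] {r s : ℕ} (T₁ : Fin r → ℕ) (T₂ : Fin s → ℕ) :
    MulAction (BraidGroup r × BraidGroup s × MulAut G) (DisjointPair G T₁ T₂) where
  smul g p := ⟨(g.2.2 • g.1 • p.1.1, g.2.2 • g.2.1 • p.1.2),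
    disjoint_smul g.1 g.2.1 g.2.2 p.1.1 p.1.2 p.2⟩
  one_smul p := by
    apply Subtype.ext
    change ((1 : MulAut G) • (1 : BraidGroup r) • p.1.1,
      (1 : MulAut G) • (1 : BraidGroup s) • p.1.2) = p.1
    simp only [one_smul]
  mul_smul g h p := by
    apply Subtype.ext
    change ((g.2.2 * h.2.2) • (g.1 * h.1) • p.1.1, (g.2.2 * h.2.2) • (g.2.1 * h.2.1) • p.1.2) =
      (g.2.2 • g.1 • h.2.2 • h.1 • p.1.1, g.2.2 • g.2.1 • h.2.2 • h.2.1 • p.1.2)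
    simp only [mul_smul, aut_smul_braid_smul]

/-! The second factor can be made standard. Braids arrange the orders of a `[2,4,6]` system as 2, 4,
6. In `S₄` the entries then become a transposition, a 4-cycle and a 3-cycle, a configuration unique
up to conjugation. The `ℤ/2`-component of the third entry is nontrivial, so exactly one of the other
two is nontrivial as well, and the twist of `ℤ/2` by the sign exchanges the two cases. Hence braids
and automorphisms carry every such system to `stdTriple`
(`SphericalSystem.exists_smul_eq_stdTriple`).

The stabilizer set of `stdTriple` contains every involution with trivial `ℤ/2`-component and the
central involution. Disjointness therefore forces the entries of the first factor into the other
nine involutions, and every nonempty tuple of these is disjoint from `stdTriple`.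

It remains to reduce 8-letter words in nine letters by braid moves alone. A lexicographically least
word of a braid orbit cannot be decreased by any braid, and its tails are least in their own orbits,
so such words can be enumerated from the right with pruning. Product one and generation leave two
words (`spherical_irreducibleWords`).

These two differ in the number of entries over double transpositions, 2 or 4. Conceptually, the
remaining entries map to transpositions that generate `S₄/V₄ ≅ S₃` with product one, so their number
is even and at least 4; it is not 8, since otherwise all entries would lie in the graph of the sign.
The number is an orbit invariant because the entries over double transpositions are those that are
squares modulo the center. -/

/-! ### Hurwitz moves on lists -/

/-- One elementary braid move on a list over a group. -/
inductive HurwitzStep {G : Type*} [Group G] : List G → List G → Prop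
  | swap (a b : G) (l : List G) : HurwitzStep (a :: b :: l) (a * b * a⁻¹ :: a :: l)
  | cons (a : G) {l m : List G} : HurwitzStep l m → HurwitzStep (a :: l) (a :: m)

/-- Reachability by elementary braid moves. -/
abbrev HurwitzReach {G : Type*} [Group G] : List G → List G → Prop :=
  Relation.ReflTransGen HurwitzStep

theorem HurwitzStep.exists_append {G : Type*} [Group G] {l m : List G} (h : HurwitzStep l m) :
    ∃ l₁ a b l₂, l = l₁ ++ a :: b :: l₂ ∧ m = l₁ ++ a * b * a⁻¹ :: a :: l₂ := by
  induction h with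
  | swap a b l => exact ⟨[], a, b, l, rfl, rfl⟩
  | cons c _ ih =>
    obtain ⟨l₁, a, b, l₂, rfl, rfl⟩ := ih
    exact ⟨c :: l₁, a, b, l₂, rfl, rfl⟩

theorem HurwitzStep.exists_move {G : Type*} [Group G] {r : ℕ} {A : Fin r → G} {m : List G}
    (h : HurwitzStep (List.ofFn A) m) : ∃ i, m = List.ofFn (Hurwitz.move i A) := by
  obtain ⟨l₁, a, b, l₂, hl, rfl⟩ := h.exists_append
  have hlen : r = l₁.length + (l₂.length + 1 + 1) := by
    simpa using congrArg List.length hl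
  have hA : ∀ k : Fin r, some (A k) = (l₁ ++ a :: b :: l₂)[k.val]? := by
    intro k
    rw [← hl]; simp
  let i : Fin (r - 1) := ⟨l₁.length, by omega⟩
  have ha : A (Hurwitz.lo i) = a := by
    have := hA (Hurwitz.lo i)
    simpa [Hurwitz.lo, i] using this
  have hb : A (Hurwitz.hi i) = b := by
    have := hA (Hurwitz.hi i)
    simpa [Hurwitz.hi, i, List.getElem?_append_right] using this
  refine ⟨i, List.ext_getElem (by simp; omega) fun k h₁ h₂ => ?_⟩
  have hk : k < r := by simpa using h₂
  have hAk := hA ⟨k, hk⟩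
  apply Option.some_injective
  rw [← List.getElem?_eq_getElem h₁, List.getElem_ofFn]
  simp only [Hurwitz.move, ha, hb]
  simp only [Hurwitz.lo, Hurwitz.hi, i, Fin.mk.injEq]
  split_ifs with h3 h4
  · simp [h3]
  · simp [h4]
  · rw [hAk]
    rcases Nat.lt_or_ge k l₁.length with h5 | h5
    · simp [List.getElem?_append_left h5]
    -- Beyond the prefix and off both moved positions, `k` lies in `l₂`.
    · obtain ⟨j, rfl⟩ : ∃ j, k = l₁.length + (j + 1 + 1) := ⟨k - l₁.length - 2, by omega⟩
      simp [List.getElem?_append_right]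

theorem hurwitzReach_cons {G : Type*} [Group G] (a : G) {l m : List G} (h : HurwitzReach l m) :
    HurwitzReach (a :: l) (a :: m) :=
  Relation.ReflTransGen.lift (a :: ·) (fun _ _ => HurwitzStep.cons a) _ _ h

/-- Moves on the list of entries of a spherical system are realised by braids. -/
theorem SphericalSystem.exists_braid_of_reach {G : Type*} [Group G] {r : ℕ} {T : Fin r → ℕ}
    (A : SphericalSystem G T) {m : List G} (h : HurwitzReach (List.ofFn A.1) m) :
    ∃ γ : BraidGroup r, List.ofFn (γ • A).1 = m := by
  induction h with
  | refl => exact ⟨1, by rw [one_smul]⟩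
  | tail _ h ih =>
    obtain ⟨γ, rfl⟩ := ih
    obtain ⟨i, rfl⟩ := h.exists_move
    refine ⟨PresentedGroup.of i * γ, ?_⟩
    rw [mul_smul]
    change List.ofFn (Hurwitz.hom T (PresentedGroup.of i) (γ • A)).1 = _
    rw [Hurwitz.hom_of]
    rfl

/-- Braids can permute the orders of the entries arbitrarily. -/
theorem SphericalSystem.exists_braid_orderOf {G : Type*} [Group G] {n : ℕ}
    {T : Fin (n + 1) → ℕ} (π : Equiv.Perm (Fin (n + 1))) :
    ∃ γ : BraidGroup (n + 1), ∀ (A : SphericalSystem G T) (k : Fin (n + 1)),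
      orderOf ((γ • A).1 k) = orderOf (A.1 (π k)) := by
  have hπ : π ∈ Submonoid.closure (Set.range fun i : Fin n => Equiv.swap i.castSucc i.succ) := by
    rw [Equiv.Perm.mclosure_swap_castSucc_succ]; trivial
  induction hπ using Submonoid.closure_induction with
  | mem x hx =>
    obtain ⟨i, rfl⟩ := hx
    refine ⟨PresentedGroup.of (rels := braidRels (n + 1)) i, fun A k => ?_⟩
    change orderOf ((Hurwitz.hom T (PresentedGroup.of i) A).1 k) = _
    rw [Hurwitz.hom_of]
    exact Hurwitz.orderOf_move (r := n + 1) i A.1 k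
  | one => exact ⟨1, fun A k => by rw [one_smul]; rfl⟩
  | mul x y _ _ hx hy =>
    obtain ⟨γ, hγ⟩ := hx
    obtain ⟨δ, hδ⟩ := hy
    refine ⟨δ * γ, fun A k => ?_⟩
    rw [mul_smul, hδ, hγ]; rfl

/-- Braids permute the conjugacy classes of the entries. -/
theorem SphericalSystem.exists_perm_isConj_braid {G : Type*} [Group G] {r : ℕ} {T : Fin r → ℕ}
    (γ : BraidGroup r) (A : SphericalSystem G T) :
    ∃ π : Equiv.Perm (Fin r), ∀ k, IsConj (A.1 (π k)) ((γ • A).1 k) := by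
  let H : Subgroup (Equiv.Perm (SphericalSystem G T)) :=
    { carrier := {p | ∀ B, ∃ π : Equiv.Perm (Fin r), ∀ k, IsConj (B.1 (π k)) ((p B).1 k)}
      mul_mem' := fun {p q} hp hq B => by
        obtain ⟨π, hπ⟩ := hp (q B)
        obtain ⟨ρ, hρ⟩ := hq B
        exact ⟨ρ * π, fun k => (hρ (π k)).trans (hπ k)⟩
      one_mem' := fun B => ⟨1, fun k => IsConj.refl _⟩
      inv_mem' := fun {p} hp B => by
        obtain ⟨π, hπ⟩ := hp (p⁻¹ B)
        have e : p (p⁻¹ B) = B := p.apply_symm_apply B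
        rw [e] at hπ
        refine ⟨π⁻¹, fun k => ?_⟩
        simpa using (hπ (π⁻¹ k)).symm }
  exact Hurwitz.hom_induction T H
    (fun i B => ⟨Equiv.swap (Hurwitz.lo i) (Hurwitz.hi i), Hurwitz.isConj_move i B.1⟩) γ A

/-! ### The nine involutions and irreducible words -/

/-- The group `S₄ × ℤ/2`. -/
abbrev S4C2 : Type := Equiv.Perm (Fin 4) × Multiplicative (ZMod 2)

/-- The involutions `(x, 1)` of `S₄ × ℤ/2` with `x ≠ 1`: six over transpositions, three over double
transpositions. -/
def involution : Fin 9 → S4C2 := fun i =>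
  (![Equiv.swap 2 3, Equiv.swap 1 2, Equiv.swap 1 3, Equiv.swap 0 1, Equiv.swap 0 2,
    Equiv.swap 0 3, Equiv.swap 0 1 * Equiv.swap 2 3, Equiv.swap 0 2 * Equiv.swap 1 3,
    Equiv.swap 0 3 * Equiv.swap 1 2] i, Multiplicative.ofAdd 1)

/-- The index of the conjugate of the `b`-th involution by the `a`-th; the table is written as one
number in base `9`. -/
def conjIndex (a b : Fin 9) : Fin 9 :=
  Fin.ofNat 9
    (193547067366594011243223701954187252309769625331874942736002986266315615787732 /
      9 ^ (9 * a.val + b.val))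

/-- Validates all 81 digits of the table, so that computations with indices are computations in the
group. -/
theorem involution_conjIndex :
    ∀ a b, involution (conjIndex a b) = involution a * involution b * (involution a)⁻¹ := by
  decide +kernel

/-- The elementary move on the first two letters of a word of indices. -/
def moveHead : List (Fin 9) → List (Fin 9)
  | a :: b :: l => conjIndex a b :: a :: l
  | l => l

/-- A map applied to the tail of a word. -/
def onTail (f : List (Fin 9) → List (Fin 9)) : List (Fin 9) → List (Fin 9)
  | [] => []
  | a :: l => a :: f l

/-- The elementary move at position `i` on words of indices (nothing happens out of range). -/
noncomputable def moveWord (i : ℕ) : List (Fin 9) → List (Fin 9) :=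
  Nat.rec moveHead (fun _ => onTail) i

/-- Words as numbers in base `9`; on words of equal length this is the lexicographic order. -/
def wordValue (l : List (Fin 9)) : ℕ := l.foldl (fun v a => 9 * v + a.val) 0

theorem wordValue_cons (a : Fin 9) (l : List (Fin 9)) :
    wordValue (a :: l) = a.val * 9 ^ l.length + wordValue l := by
  have key : ∀ (l : List (Fin 9)) (v : ℕ),
      l.foldl (fun v a => 9 * v + a.val) v = v * 9 ^ l.length + wordValue l := by
    intro l
    induction l with
    | nil => intro v; simp [wordValue]
    | cons a l ih =>
      intro v
      have e : wordValue (a :: l) = l.foldl (fun v a => 9 * v + a.val) (9 * 0 + a.val) := rfl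
      rw [e, List.foldl_cons, ih, ih, List.length_cons, pow_succ]
      ring
  have e : wordValue (a :: l) = l.foldl (fun v a => 9 * v + a.val) (9 * 0 + a.val) := rfl
  rw [e, key, mul_zero, zero_add]

theorem wordValue_lt (l : List (Fin 9)) : wordValue l < 9 ^ l.length := by
  induction l with
  | nil => simp [wordValue]
  | cons a l ih =>
    rw [wordValue_cons, List.length_cons, pow_succ]
    have := Nat.mul_le_mul_right (9 ^ l.length) (Nat.le_of_lt_succ a.isLt)
    omega

/-- Lexicographic comparison. -/
def lexLe : List (Fin 9) → List (Fin 9) → Bool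
  | a :: l, b :: m => Nat.blt a.val b.val || (Nat.beq a.val b.val && lexLe l m)
  | _, _ => true

/-- The leading digit dominates because the tail has value below `9 ^ l.length`. Numerical values
serve to choose a minimum, digitwise comparison serves the kernel computation. -/
theorem lexLe_of_wordValue_le {l m : List (Fin 9)} (hlen : m.length = l.length)
    (h : wordValue l ≤ wordValue m) : lexLe l m = true := by
  induction l generalizing m with
  | nil => simp [lexLe]
  | cons a l ih =>
    obtain _ | ⟨b, m⟩ := m
    · simp [lexLe]
    simp only [List.length_cons, Nat.add_right_cancel_iff] at hlen
    rw [wordValue_cons, wordValue_cons, hlen] at h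
    have hm := wordValue_lt m
    rw [hlen] at hm
    simp only [lexLe, Bool.or_eq_true, Bool.and_eq_true, Nat.blt_eq, Nat.beq_eq]
    rcases Nat.lt_trichotomy a.val b.val with hab | hab | hab
    · exact .inl hab
    · rw [hab] at h
      exact .inr ⟨hab, ih hlen (by omega)⟩
    · have := Nat.mul_le_mul_right (9 ^ l.length) (Nat.succ_le_of_lt hab)
      rw [Nat.succ_mul] at this
      omega

theorem moveWord_length (i : ℕ) (l : List (Fin 9)) : (moveWord i l).length = l.length := by
  induction i generalizing l with
  | zero => rcases l with _ | ⟨a, _ | ⟨b, l⟩⟩ <;> rfl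
  | succ i ih =>
    rcases l with _ | ⟨a, l⟩
    · rfl
    · exact congrArg Nat.succ (ih l)

theorem reach_moveWord (i : ℕ) (l : List (Fin 9)) :
    HurwitzReach (l.map involution) ((moveWord i l).map involution) := by
  induction i generalizing l with
  | zero =>
    rcases l with _ | ⟨a, _ | ⟨b, l⟩⟩
    · exact .refl
    · exact .refl
    · change HurwitzReach _ (involution (conjIndex a b) :: involution a :: l.map involution)
      rw [involution_conjIndex]
      exact .single (.swap _ _ _)
  | succ i ih =>
    rcases l with _ | ⟨a, l⟩
    · exact .refl
    · exact hurwitzReach_cons _ (ih l)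

/-- The result of a sequence of moves. -/
noncomputable def moveSeq (w : List ℕ) (l : List (Fin 9)) : List (Fin 9) := w.foldl (fun l i => moveWord i l) l

theorem moveSeq_length (w : List ℕ) (l : List (Fin 9)) : (moveSeq w l).length = l.length := by
  induction w generalizing l with
  | nil => rfl
  | cons i w ih => exact (ih _).trans (moveWord_length i l)

theorem reach_moveSeq (w : List ℕ) (l : List (Fin 9)) :
    HurwitzReach (l.map involution) ((moveSeq w l).map involution) := by
  induction w generalizing l with
  | nil => exact .refl
  | cons i w ih => exact (reach_moveWord i l).trans (ih _)

/-- Move sequences that suffice to reduce words to normal form. -/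
def reducers : List (List ℕ) :=
  [[0], [0, 0], [0, 1, 1, 0], [0, 1, 1, 0, 2, 1, 1], [2, 1, 0, 3, 2, 1, 1, 0],
    [0, 0, 1, 1, 2, 3, 4, 5, 5, 4, 3, 2, 1, 0]]

/-- No reducer makes the word smaller. -/
noncomputable def headIrreducible (l : List (Fin 9)) : Bool :=
  reducers.all fun w => lexLe l (moveSeq w l)

/-- The words of length `n` that no reducer makes smaller at any position. -/
noncomputable def irreducibleWords : ℕ → List (List (Fin 9))
  | 0 => [[]]
  | n + 1 => (irreducibleWords n).flatMap fun l =>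
      ((List.finRange 9).map fun a => a :: l).filter headIrreducible

/-- A braid that decreased the tail would decrease the whole word, so tails of minimal words are
minimal and only reducers applied at the head need testing. Any list of reducers is sound here, even
on short words, since moves out of range do nothing. -/
theorem mem_irreducibleWords {l : List (Fin 9)}
    (h : ∀ m : List (Fin 9), m.length = l.length →
      HurwitzReach (l.map involution) (m.map involution) → wordValue l ≤ wordValue m) :
    l ∈ irreducibleWords l.length := by
  induction l with
  | nil => simp [irreducibleWords]
  | cons a l ih =>
    have hl := ih fun m hm hr => by
      have := h (a :: m) (by simp [hm]) (hurwitzReach_cons _ hr)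
      rw [wordValue_cons, wordValue_cons, hm] at this
      omega
    rw [List.length_cons, irreducibleWords, List.mem_flatMap]
    refine ⟨l, hl, List.mem_filter.mpr ⟨List.mem_map.mpr ⟨a, List.mem_finRange a, rfl⟩, ?_⟩⟩
    rw [headIrreducible, List.all_eq_true]
    intro w _
    exact lexLe_of_wordValue_le (moveSeq_length w _) (h _ (moveSeq_length w _) (reach_moveSeq w _))

theorem exists_reach_irreducible (l : List (Fin 9)) :
    ∃ m ∈ irreducibleWords l.length, HurwitzReach (l.map involution) (m.map involution) := by
  let S : Set (List (Fin 9)) :=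
    {m | m.length = l.length ∧ HurwitzReach (l.map involution) (m.map involution)}
  have hS : S.Nonempty := ⟨l, rfl, .refl⟩
  have hmem := Function.argminOn_mem wordValue S hS
  refine ⟨Function.argminOn wordValue S hS, ?_, hmem.2⟩
  rw [← hmem.1]
  refine mem_irreducibleWords fun m hm hr => ?_
  exact Function.argminOn_le wordValue S ⟨hm.trans hmem.1, hmem.2.trans hr⟩

/-- The necessary conditions on words of indices of generating tuples with product `1`. -/
def sphericalWord (l : List (Fin 9)) : Bool :=
  (List.finRange 4).all (fun j => l.foldr (fun a k => (involution a).1 k) j == j) &&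
  l.any (fun a => Nat.ble 6 a.val) &&
  [6, 7, 8].all (fun d => l.any fun a => conjIndex a d != d)

/-- The finite enumeration. The choice of `reducers` matters only here: the six sequences prune
enough that each possible number of double transpositions leaves one word. -/
theorem spherical_irreducibleWords :
    (irreducibleWords 8).filter sphericalWord =
      [[0, 0, 0, 0, 1, 1, 6, 6], [0, 0, 1, 1, 6, 6, 6, 6]] := by
  decide +kernel

/-! ### Subgroups and automorphisms of `S₄ × ℤ/2` -/

/-- The generator of `ℤ/2`, written multiplicatively. -/
abbrev gen2 : Multiplicative (ZMod 2) := Multiplicative.ofAdd 1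

theorem eq_one_or_gen2 : ∀ z : Multiplicative (ZMod 2), z = 1 ∨ z = gen2 := by decide

theorem S4C2.eq_top {H : Subgroup S4C2}
    (h01 : ((Equiv.swap 0 1, 1) : S4C2) ∈ H) (h12 : ((Equiv.swap 1 2, 1) : S4C2) ∈ H)
    (h23 : ((Equiv.swap 2 3, 1) : S4C2) ∈ H) (hz : ((1, gen2) : S4C2) ∈ H) : H = ⊤ := by
  have h1 : ∀ x : Equiv.Perm (Fin 4), ((x, 1) : S4C2) ∈ H := by
    intro x
    have hx : x ∈ Submonoid.closure
        (Set.range fun i : Fin 3 => Equiv.swap i.castSucc i.succ) := by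
      rw [Equiv.Perm.mclosure_swap_castSucc_succ]; trivial
    induction hx using Submonoid.closure_induction with
    | mem x hx =>
      obtain ⟨i, rfl⟩ := hx
      fin_cases i
      exacts [h01, h12, h23]
    | one => exact one_mem _
    | mul x y _ _ hx hy => exact mul_mem hx hy
  rw [eq_top_iff]
  rintro ⟨x, z⟩ -
  rcases eq_one_or_gen2 z with rfl | rfl
  · exact h1 x
  · exact mul_mem (h1 x) hz

theorem S4C2.eq_top_of_involution {H : Subgroup S4C2} (h0 : involution 0 ∈ H)
    (h1 : involution 1 ∈ H) (h6 : involution 6 ∈ H) : H = ⊤ := by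
  have h01 : ((Equiv.swap 0 1, 1) : S4C2) ∈ H := by
    have e : ((Equiv.swap 0 1, 1) : S4C2) = involution 0 * involution 6 := by decide
    exact e ▸ mul_mem h0 h6
  have h02 : ((Equiv.swap 0 2, 1) : S4C2) ∈ H := by
    have e : ((Equiv.swap 0 2, 1) : S4C2) = involution 1 * (Equiv.swap 0 1, 1) * involution 1 := by
      decide
    exact e ▸ mul_mem (mul_mem h1 h01) h1
  have h12 : ((Equiv.swap 1 2, 1) : S4C2) ∈ H := by
    have e : ((Equiv.swap 1 2, 1) : S4C2) =
        (Equiv.swap 0 1, 1) * (Equiv.swap 0 2, 1) * (Equiv.swap 0 1, 1) := by decide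
    exact e ▸ mul_mem (mul_mem h01 h02) h01
  have h23 : ((Equiv.swap 2 3, 1) : S4C2) ∈ H := by
    have e : ((Equiv.swap 2 3, 1) : S4C2) = (Equiv.swap 1 2, 1) *
        (involution 6 * (Equiv.swap 0 2, 1) * involution 6) * (Equiv.swap 1 2, 1) := by decide
    exact e ▸ mul_mem (mul_mem h12 (mul_mem (mul_mem h6 h02) h6)) h12
  have hz : ((1, gen2) : S4C2) ∈ H := by
    have e : ((1, gen2) : S4C2) = involution 0 * (Equiv.swap 2 3, 1) := by decide
    exact e ▸ mul_mem h0 h23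
  exact S4C2.eq_top h01 h12 h23 hz

/-- The sign of a permutation with values in `ℤ/2`. -/
def parity : Equiv.Perm (Fin 4) →* Multiplicative (ZMod 2) :=
  (MonoidHom.mk' (fun u : ℤˣ => if u = 1 then 1 else gen2) (by decide)).comp Equiv.Perm.sign

/-- The automorphism `(x, z) ↦ (x, z + sgn x)`. -/
def signTwist : MulAut S4C2 where
  toFun g := (g.1, g.2 * parity g.1)
  invFun g := (g.1, g.2 * parity g.1)
  left_inv g := by
    have h : ∀ z : Multiplicative (ZMod 2), z * z = 1 := by decide
    simp [mul_assoc, h]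
  right_inv g := by
    have h : ∀ z : Multiplicative (ZMod 2), z * z = 1 := by decide
    simp [mul_assoc, h]
  map_mul' g h := by
    simp only [Prod.fst_mul, Prod.snd_mul, map_mul, Prod.mk_mul_mk, Prod.mk.injEq, true_and]
    exact mul_mul_mul_comm _ _ _ _

theorem pow_eq_one_of_orderOf_eq {G : Type*} [Monoid G] {g : G} {n : ℕ} (h : orderOf g = n) :
    g ^ n = 1 := h ▸ pow_orderOf_eq_one g

/-! ### Triples of type `[2, 4, 6]` -/

/-- The standard triple of type `[2, 4, 6]`. -/
def stdTriple : Fin 3 → S4C2 :=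
  ![(Equiv.swap 0 1, 1), (finRotate 4, gen2), ((Equiv.swap 0 1 * finRotate 4)⁻¹, gen2)]

/-- Here `y` is a 4-cycle and `x * y` a 3-cycle, so `x` is odd, hence a transposition. It must swap
two neighbours in the cycle `y`, as swapping opposite points gives a product of order 2; powers of
`y` permute the four choices. -/
theorem perm_pair_conj : ∀ x y : Equiv.Perm (Fin 4),
    (x ^ 2 = 1 ∧ y ^ 2 ≠ 1 ∧ y ^ 4 = 1 ∧ (x * y) ^ 3 = 1 ∧ x * y ≠ 1) →
      ∃ h, h * x * h⁻¹ = Equiv.swap 0 1 ∧ h * y * h⁻¹ = finRotate 4 := by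
  decide +kernel

theorem perm_pow_three : ∀ x : Equiv.Perm (Fin 4), x ^ 6 = 1 → x ^ 2 ≠ 1 → x ^ 3 = 1 := by
  decide +kernel

theorem exists_aut_eq_stdTriple {B : Fin 3 → S4C2} (hprod : B 0 * B 1 * B 2 = 1)
    (h0 : orderOf (B 0) = 2) (h1 : orderOf (B 1) = 4) (h2 : orderOf (B 2) = 6) :
    ∃ φ : MulAut S4C2, ∀ k, φ (B k) = stdTriple k := by
  have hne : ∀ {g : S4C2} {n : ℕ} (m : ℕ), orderOf g = n → 0 < m → m < n → g ^ m ≠ 1 :=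
    fun m hg h0 hm => pow_ne_one_of_lt_orderOf h0.ne' (hg ▸ hm)
  have e0 : B 0 ^ 2 = 1 := pow_eq_one_of_orderOf_eq h0
  have e1 : B 1 ^ 4 = 1 := pow_eq_one_of_orderOf_eq h1
  have e2 : B 2 ^ 6 = 1 := pow_eq_one_of_orderOf_eq h2
  have n1 := hne 2 h1 (by decide) (by decide)
  have n2 := hne 2 h2 (by decide) (by decide)
  have n3 := hne 3 h2 (by decide) (by decide)
  suffices h : ∃ φ : MulAut S4C2, φ (B 0) = stdTriple 0 ∧ φ (B 1) = stdTriple 1 by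
    obtain ⟨φ, p0, p1⟩ := h
    refine ⟨φ, fun k => ?_⟩
    have p2 : φ (B 2) = stdTriple 2 := by
      rw [eq_inv_of_mul_eq_one_right hprod, map_inv, map_mul, p0, p1]
      decide
    fin_cases k
    exacts [p0, p1, p2]
  clear h0 h1 h2
  generalize B 0 = b₀ at *
  generalize B 1 = b₁ at *
  generalize B 2 = b₂ at *
  obtain ⟨x, u⟩ := b₀
  obtain ⟨y, v⟩ := b₁
  obtain ⟨w, t⟩ := b₂
  have hz : ∀ z : Multiplicative (ZMod 2), z ^ 2 = 1 := by decide
  have hz3 : ∀ z : Multiplicative (ZMod 2), z ^ 3 = z := by decide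
  simp only [Prod.mk_mul_mk, Prod.pow_mk, Prod.mk_eq_one, hz, hz3, and_true, ne_eq, not_and]
    at hprod e0 e1 e2 n1 n2 n3
  have hw3 := perm_pow_three w e2.1 n2
  have hxy : x * y = w⁻¹ := eq_inv_of_mul_eq_one_left hprod.1
  obtain ⟨h, hx, hy⟩ := perm_pair_conj x y ⟨e0, n1, e1.1, by rw [hxy, inv_pow, hw3, inv_one], by
    rw [hxy, ne_eq, inv_eq_one]
    rintro rfl
    exact n2 (one_pow 2)⟩
  have ht : t ≠ 1 := n3 hw3
  have huv : (u = 1 ∧ v = gen2) ∨ (u = gen2 ∧ v = 1) := by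
    have : ∀ u v t : Multiplicative (ZMod 2), u * v * t = 1 → t ≠ 1 →
        (u = 1 ∧ v = gen2) ∨ (u = gen2 ∧ v = 1) := by decide
    exact this u v t hprod.2 ht
  have hconj : ∀ (x : Equiv.Perm (Fin 4)) (u : Multiplicative (ZMod 2)),
      MulAut.conj ((h, 1) : S4C2) (x, u) = (h * x * h⁻¹, u) := by
    intro x u
    simp [MulAut.conj_apply]
  rcases huv with ⟨rfl, rfl⟩ | ⟨rfl, rfl⟩
  · refine ⟨MulAut.conj (h, 1), ?_, ?_⟩
    · rw [hconj, hx]; rfl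
    · rw [hconj, hy]; rfl
  -- Both permutations are odd, so the twist flips both `ℤ/2`-components.
  · refine ⟨signTwist * MulAut.conj (h, 1), ?_, ?_⟩
    · rw [MulAut.mul_apply, hconj, hx]; decide
    · rw [MulAut.mul_apply, hconj, hy]; decide

theorem SphericalSystem.exists_smul_eq_stdTriple (A : SphericalSystem S4C2 ![2, 4, 6]) :
    ∃ (γ : BraidGroup 3) (φ : MulAut S4C2), (φ • γ • A).1 = stdTriple := by
  obtain ⟨τ, hτ⟩ := A.2.orders
  obtain ⟨γ, hγ⟩ := SphericalSystem.exists_braid_orderOf (G := S4C2) (T := ![2, 4, 6]) τ⁻¹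
  have ho : ∀ k, orderOf ((γ • A).1 k) = ![2, 4, 6] k := fun k => by
    rw [hγ, hτ]
    exact congrArg _ (τ.apply_symm_apply k)
  have hp := (γ • A).2.prod_eq_one
  simp only [List.ofFn_succ, List.ofFn_zero, List.prod_cons, List.prod_nil, mul_one,
    ← mul_assoc] at hp
  obtain ⟨φ, hφ⟩ := exists_aut_eq_stdTriple hp (ho 0) (ho 1) (ho 2)
  exact ⟨γ, φ, funext hφ⟩

theorem isSphericalSystem_stdTriple : IsSphericalSystem ![2, 4, 6] stdTriple where
  generates := by
    have h0 : stdTriple 0 ∈ Subgroup.closure (Set.range stdTriple) :=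
      Subgroup.subset_closure ⟨0, rfl⟩
    have h1 : stdTriple 1 ∈ Subgroup.closure (Set.range stdTriple) :=
      Subgroup.subset_closure ⟨1, rfl⟩
    have h2 : stdTriple 2 ∈ Subgroup.closure (Set.range stdTriple) :=
      Subgroup.subset_closure ⟨2, rfl⟩
    have h12 : ((Equiv.swap 1 2, 1) : S4C2) ∈ Subgroup.closure (Set.range stdTriple) := by
      have e : ((Equiv.swap 1 2, 1) : S4C2) = stdTriple 1 * stdTriple 0 * (stdTriple 1)⁻¹ := by
        decide
      exact e ▸ mul_mem (mul_mem h1 h0) (inv_mem h1)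
    refine S4C2.eq_top h0 h12 ?_ ?_
    · have e : ((Equiv.swap 2 3, 1) : S4C2) =
          stdTriple 1 * (Equiv.swap 1 2, 1) * (stdTriple 1)⁻¹ := by decide
      exact e ▸ mul_mem (mul_mem h1 h12) (inv_mem h1)
    · have e : ((1, gen2) : S4C2) = stdTriple 2 ^ 3 := by decide
      exact e ▸ pow_mem h2 3
  prod_eq_one := by decide
  orders := by
    refine ⟨1, fun k => ?_⟩
    fin_cases k
    · exact (orderOf_eq_iff (by decide)).mpr (by decide)
    · exact (orderOf_eq_iff (by decide)).mpr (by decide)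
    · exact (orderOf_eq_iff (by decide)).mpr (by decide)

/-! ### Tuples of the nine involutions -/

theorem perm_involution_cases : ∀ x : Equiv.Perm (Fin 4), x ^ 2 = 1 → x ≠ 1 →
    ((∃ h : Equiv.Perm (Fin 4), x = h * Equiv.swap 0 1 * h⁻¹) ∨
      ∃ h : Equiv.Perm (Fin 4), x = h * finRotate 4 ^ 2 * h⁻¹) ∧
    ∃ c, (x, gen2) = involution c := by
  decide +kernel

theorem exists_involution_of_not_mem {g : S4C2} (ho : orderOf g = 2)
    (hg : g ∉ stabilizerSet stdTriple) : ∃ c, g = involution c := by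
  obtain ⟨x, z⟩ := g
  have h2 : ((x, z) : S4C2) ^ 2 = 1 := pow_eq_one_of_orderOf_eq ho
  have hne : ((x, z) : S4C2) ≠ 1 := by
    rintro h
    rw [h, orderOf_one] at ho
    exact absurd ho (by decide)
  have hx2 : x ^ 2 = 1 := congrArg Prod.fst h2
  rw [mem_stabilizerSet] at hg
  rcases eq_or_ne x 1 with rfl | hx
  · rcases eq_one_or_gen2 z with rfl | rfl
    · exact absurd rfl hne
    -- The central involution is the cube of the entry of order 6.
    · exact absurd ⟨1, 3, 2, by decide⟩ hg
  obtain ⟨hc, c, hinv⟩ := perm_involution_cases x hx2 hx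
  rcases eq_one_or_gen2 z with rfl | rfl
  · refine absurd ?_ hg
    rcases hc with ⟨h, rfl⟩ | ⟨h, rfl⟩
    · exact ⟨(h, 1), 1, 0, by simp [stdTriple]⟩
    -- Double transpositions are squares of 4-cycles.
    · exact ⟨(h, 1), 2, 1, Prod.ext rfl (by simp [stdTriple]; decide)⟩
  · exact ⟨c, hinv⟩

/-- A power of a `stdTriple` entry with nontrivial `ℤ/2`-component lies over the identity, a 3-cycle
or a 4-cycle, never over an involution of `S₄`. Nonemptiness of the tuple puts `1` in its stabilizer
set. -/
theorem stabilizerSet_inter_stdTriple {r : ℕ} (w : Fin (r + 1) → Fin 9) :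
    stabilizerSet (fun k => involution (w k)) ∩ stabilizerSet stdTriple = {1} := by
  apply Set.Subset.antisymm
  · rintro g ⟨h1, h2⟩
    obtain ⟨h, j, i, rfl⟩ := mem_stabilizerSet.mp h1
    obtain ⟨h', j', i', e⟩ := mem_stabilizerSet.mp h2
    have hsq : ∀ c, involution c ^ (2 : ℕ) = 1 := by decide
    -- 12 is the least common multiple of 2, 4 and 6; it bounds the exponents to be checked.
    have h12 : ∀ i, stdTriple i ^ (12 : ℕ) = 1 := by decide +kernel
    have hj : ∀ g : S4C2, ∀ n : ℕ, 0 < n → g ^ n = 1 → ∀ j : ℤ, ∃ m < n, g ^ j = g ^ m := by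
      intro g n hn hg j
      obtain ⟨m, hm⟩ := Int.eq_ofNat_of_zero_le (Int.emod_nonneg j (by omega : (n : ℤ) ≠ 0))
      refine ⟨m, by have := Int.emod_lt_of_pos j (by omega : (0 : ℤ) < n); omega, ?_⟩
      rw [← Int.emod_add_mul_ediv j n, hm, zpow_add, zpow_mul, zpow_natCast, zpow_natCast, hg,
        one_zpow, mul_one]
    obtain ⟨m, hm, em⟩ := hj _ 2 (by decide) (hsq (w i)) j
    obtain ⟨m', hm', em'⟩ := hj _ 12 (by decide) (h12 i') j'
    rw [em, em'] at e
    rw [em, Set.mem_singleton_iff]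
    interval_cases m
    · simp
    exfalso
    rw [pow_one] at e
    have hnot : ∀ i, ∀ m < 12, (stdTriple i ^ m).2 = gen2 →
        (stdTriple i ^ m).1 = 1 ∨ (stdTriple i ^ m).1 ^ 2 ≠ 1 := by decide +kernel
    have hinv : ∀ c, (involution c).1 ≠ 1 ∧ (involution c).1 ^ 2 = 1 ∧
        (involution c).2 = gen2 := by decide
    obtain ⟨i1, i2, i3⟩ := hinv (w i)
    have ec : stdTriple i' ^ m' = (h'⁻¹ * h) * involution (w i) * (h'⁻¹ * h)⁻¹ := by
      have : stdTriple i' ^ m' = h'⁻¹ * (h' * stdTriple i' ^ m' * h'⁻¹) * h' := by group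
      rw [this, ← e]; group
    have e1 := congrArg Prod.fst ec
    have e2 := congrArg Prod.snd ec
    simp only [Prod.fst_mul, Prod.fst_inv, Prod.snd_mul, Prod.snd_inv] at e1 e2
    rw [mul_inv_cancel_comm, i3] at e2
    rcases hnot i' m' hm' e2 with h0 | h0
    · rw [h0, eq_comm, conj_eq_one_iff] at e1
      exact i1 e1
    · rw [e1, conj_pow, i2, mul_one, mul_inv_cancel] at h0
      exact h0 rfl
  · rintro _ rfl
    exact ⟨mem_stabilizerSet.mpr ⟨1, 0, 0, by simp⟩, mem_stabilizerSet.mpr ⟨1, 0, 0, by simp⟩⟩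

theorem sphericalWord_of_isSphericalSystem {r : ℕ} {T : Fin r → ℕ} {B : Fin r → S4C2}
    (hB : IsSphericalSystem T B) {m : List (Fin 9)} (hm : List.ofFn B = m.map involution) :
    sphericalWord m = true := by
  have hmem : ∀ k, ∃ a ∈ m, involution a = B k := fun k => by
    rw [← List.mem_map, ← hm, List.mem_ofFn]
    exact ⟨k, rfl⟩
  have htop : ∀ H : Subgroup S4C2, (∀ a ∈ m, involution a ∈ H) → ∀ g, g ∈ H := by
    intro H h g
    have hle : Subgroup.closure (Set.range B) ≤ H := by
      rw [Subgroup.closure_le]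
      rintro _ ⟨k, rfl⟩
      obtain ⟨a, ha, e⟩ := hmem k
      exact e ▸ h a ha
    exact hle (hB.generates ▸ Subgroup.mem_top g)
  rw [sphericalWord, Bool.and_eq_true, Bool.and_eq_true]
  refine ⟨⟨?_, ?_⟩, ?_⟩
  · rw [List.all_eq_true]
    intro j _
    have key : ∀ l : List (Fin 9),
        l.foldr (fun a k => (involution a).1 k) j = (l.map involution).prod.1 j := by
      intro l
      induction l with
      | nil => rfl
      | cons a l ih => rw [List.foldr_cons, ih]; rfl
    rw [key, ← hm, hB.prod_eq_one, beq_iff_eq]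
    rfl
  · by_contra hno
    have hker : ∀ a : Fin 9, ¬ 6 ≤ a.val → parity (involution a).1 * (involution a).2 = 1 := by
      decide
    -- This kernel is the graph of the sign. It contains the involutions over transpositions but not
    -- the central one.
    have h := htop ((parity.comp (MonoidHom.fst _ _)) * MonoidHom.snd _ _).ker (fun a ha => by
      refine hker a fun h6 => hno ?_
      exact List.any_eq_true.mpr ⟨a, ha, Nat.ble_eq.mpr h6⟩) (1, gen2)
    rw [MonoidHom.mem_ker] at h
    exact absurd h (by decide)
  · rw [List.all_eq_true]
    intro d hd
    by_contra hno
    have hcomm : ∀ a b : Fin 9, conjIndex a b = b → involution a * involution b =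
        involution b * involution a := by
      decide
    -- If every letter commuted with this double transposition, it would be central.
    have h := htop (Subgroup.centralizer {involution d}) fun a ha => by
      rw [Subgroup.mem_centralizer_singleton_iff]
      refine hcomm a d ?_
      by_contra hne
      exact hno (List.any_eq_true.mpr ⟨a, ha, bne_iff_ne.mpr hne⟩)
    have h0 := Subgroup.mem_centralizer_singleton_iff.mp (h (Equiv.swap 0 1, 1))
    have h1 := Subgroup.mem_centralizer_singleton_iff.mp (h (Equiv.swap 1 2, 1))
    have hd' : d = 6 ∨ d = 7 ∨ d = 8 := by simpa using hd
    rcases hd' with rfl | rfl | rfl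
    · exact absurd h1 (by decide)
    · exact absurd h0 (by decide)
    · exact absurd h0 (by decide)

/-- The two normal forms, with two respectively four double transpositions. -/
def normalWord : Bool → Fin 8 → Fin 9
  | false => ![0, 0, 0, 0, 1, 1, 6, 6]
  | true => ![0, 0, 1, 1, 6, 6, 6, 6]

theorem isSphericalSystem_normalWord (b : Bool) :
    IsSphericalSystem (fun _ => 2) (fun k => involution (normalWord b k)) where
  generates := by
    have h : ∀ c ∈ [(0 : Fin 9), 1, 6], ∃ k, normalWord b k = c := by
      revert b; decide
    have h' : ∀ c ∈ [(0 : Fin 9), 1, 6], involution c ∈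
        Subgroup.closure (Set.range fun k => involution (normalWord b k)) := fun c hc => by
      obtain ⟨k, rfl⟩ := h c hc
      exact Subgroup.subset_closure ⟨k, rfl⟩
    exact S4C2.eq_top_of_involution (h' 0 (by simp)) (h' 1 (by simp)) (h' 6 (by simp))
  prod_eq_one := by revert b; decide +kernel
  orders := by
    have h : ∀ c, involution c ^ (2 : ℕ) = 1 ∧ involution c ≠ 1 := by decide
    exact ⟨1, fun k => orderOf_eq_prime (h _).1 (h _).2⟩

/-- The two standard disjoint pairs. -/
def normalPair (b : Bool) : DisjointPair S4C2 (fun _ : Fin 8 => 2) ![2, 4, 6] :=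
  ⟨(⟨_, isSphericalSystem_normalWord b⟩, ⟨_, isSphericalSystem_stdTriple⟩),
    stabilizerSet_inter_stdTriple _⟩

theorem exists_smul_eq_normalPair (p : DisjointPair S4C2 (fun _ : Fin 8 => 2) ![2, 4, 6]) :
    ∃ (g : BraidGroup 8 × BraidGroup 3 × MulAut S4C2) (b : Bool), g • p = normalPair b := by
  obtain ⟨γ₂, φ, h₂⟩ := p.1.2.exists_smul_eq_stdTriple
  let q := ((1, γ₂, φ) : BraidGroup 8 × BraidGroup 3 × MulAut S4C2) • p
  have hq₂ : q.1.2.1 = stdTriple := h₂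
  have hinv : ∀ k, ∃ c, q.1.1.1 k = involution c := by
    intro k
    obtain ⟨τ, hτ⟩ := q.1.1.2.orders
    refine exists_involution_of_not_mem (hτ k) fun hmem => ?_
    have h1 : q.1.1.1 k ∈ ({1} : Set S4C2) := by
      have hq := q.2
      rw [hq₂] at hq
      exact (Set.ext_iff.mp hq _).mp ⟨mem_stabilizerSet.mpr ⟨1, 1, k, by simp⟩, hmem⟩
    have := hτ k
    rw [Set.mem_singleton_iff.mp h1, orderOf_one] at this
    exact absurd this (by decide)
  choose c hc using hinv
  have hlist : List.ofFn q.1.1.1 = (List.ofFn c).map involution := by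
    rw [List.map_ofFn]
    exact congrArg List.ofFn (funext hc)
  obtain ⟨m, hm, hreach⟩ := exists_reach_irreducible (List.ofFn c)
  rw [← hlist] at hreach
  rw [List.length_ofFn] at hm
  obtain ⟨γ₁, hγ₁⟩ := q.1.1.exists_braid_of_reach hreach
  have hsw := sphericalWord_of_isSphericalSystem (γ₁ • q.1.1).2 hγ₁
  have hmem := List.mem_filter.mpr ⟨hm, hsw⟩
  rw [spherical_irreducibleWords] at hmem
  obtain ⟨b, rfl⟩ : ∃ b, m = List.ofFn (normalWord b) := by
    have : m = [0, 0, 0, 0, 1, 1, 6, 6] ∨ m = [0, 0, 1, 1, 6, 6, 6, 6] := by simpa using hmem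
    rcases this with rfl | rfl
    · exact ⟨false, rfl⟩
    · exact ⟨true, rfl⟩
  refine ⟨(γ₁, 1, 1) * (1, γ₂, φ), b, ?_⟩
  rw [mul_smul]
  rw [List.map_ofFn] at hγ₁
  have e1 : (γ₁ • q.1.1).1 = fun k => involution (normalWord b k) := List.ofFn_injective hγ₁
  apply Subtype.ext
  apply Prod.ext
  · exact Subtype.ext e1
  · change (1 : MulAut S4C2) • (1 : BraidGroup 3) • q.1.2 = _
    rw [one_smul, one_smul]
    exact Subtype.ext hq₂

/-! ### The invariant that separates the two orbits -/

/-- An element is a square up to central elements. -/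
def IsSquareModCenter {G : Type*} [Group G] (g : G) : Prop :=
  ∃ a z : G, z ∈ Subgroup.center G ∧ g = a ^ 2 * z

theorem IsSquareModCenter.map {G : Type*} [Group G] {g : G} (h : IsSquareModCenter g)
    (φ : MulAut G) : IsSquareModCenter (φ g) := by
  obtain ⟨a, z, hz, rfl⟩ := h
  refine ⟨φ a, φ z, Subgroup.mem_center_iff.mpr fun y => ?_, by rw [map_mul, map_pow]⟩
  have := congrArg φ (Subgroup.mem_center_iff.mp hz (φ.symm y))
  simpa using this

theorem isSquareModCenter_map_iff {G : Type*} [Group G] {g : G} (φ : MulAut G) :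
    IsSquareModCenter (φ g) ↔ IsSquareModCenter g := by
  refine ⟨fun h => ?_, fun h => h.map φ⟩
  have := h.map φ⁻¹
  rwa [MulAut.inv_apply_self] at this

theorem IsConj.isSquareModCenter_iff {G : Type*} [Group G] {g h : G} (hc : IsConj g h) :
    IsSquareModCenter g ↔ IsSquareModCenter h := by
  obtain ⟨c, rfl⟩ := isConj_iff.mp hc
  rw [← MulAut.conj_apply, isSquareModCenter_map_iff]

/-- The number of entries that are squares up to central elements. -/
noncomputable def squareCount {G : Type*} [Group G] {r : ℕ} (A : Fin r → G) : ℕ :=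
  Nat.card {k // IsSquareModCenter (A k)}

/-- Braids permute the conjugacy classes of the entries, and being a square modulo the center is
preserved by every automorphism; no description of `Aut(G)` is needed. -/
theorem squareCount_smul {G : Type*} [Group G] {r : ℕ} {T : Fin r → ℕ} (φ : MulAut G)
    (γ : BraidGroup r) (A : SphericalSystem G T) :
    squareCount (φ • γ • A).1 = squareCount A.1 := by
  obtain ⟨π, hπ⟩ := SphericalSystem.exists_perm_isConj_braid γ A
  exact Nat.card_congr (π.subtypeEquiv fun k =>
    (isSquareModCenter_map_iff φ).trans (hπ k).isSquareModCenter_iff.symm)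

/-- Squares and central elements have even `S₄`-component, which rules out transpositions.
Conversely a double transposition is the square of a 4-cycle, and the central factor supplies the
`ℤ/2`-component, which no square has. -/
theorem isSquareModCenter_involution_iff (c : Fin 9) :
    IsSquareModCenter (involution c) ↔ 6 ≤ c.val := by
  constructor
  · rintro ⟨a, z, hz, h⟩
    have h1 : parity (involution c).1 = parity z.1 := by
      have hsq : ∀ u : Multiplicative (ZMod 2), u ^ 2 = 1 := by decide
      rw [h, Prod.fst_mul, map_mul, Prod.pow_fst, map_pow, hsq, one_mul]
    have h2 : parity z.1 = 1 := by
      have hc : ∀ x : Equiv.Perm (Fin 4), (∀ y, y * x = x * y) → parity x = 1 := by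
        decide +kernel
      exact hc z.1 fun y => congrArg Prod.fst (Subgroup.mem_center_iff.mp hz (y, 1))
    have h3 : ∀ c, parity (involution c).1 = 1 → 6 ≤ c.val := by decide
    exact h3 c (h1.trans h2)
  · intro hc
    have h : ∀ c : Fin 9, 6 ≤ c.val → ∃ x : Equiv.Perm (Fin 4), (involution c).1 = x ^ 2 := by
      decide +kernel
    have h2 : ∀ c, (involution c).2 = gen2 := by decide
    obtain ⟨x, hx⟩ := h c hc
    refine ⟨(x, 1), (1, gen2), Subgroup.mem_center_iff.mpr fun y => ?_, ?_⟩
    · exact Prod.ext (by simp) (mul_comm _ _)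
    · exact Prod.ext (by simp [hx]) (by simp [h2])

theorem squareCount_normalWord (b : Bool) :
    squareCount (fun k => involution (normalWord b k)) = if b then 4 else 2 := by
  have e : squareCount (fun k => involution (normalWord b k)) =
      Nat.card {k // 6 ≤ (normalWord b k).val} :=
    Nat.card_congr (Equiv.subtypeEquivRight fun k => isSquareModCenter_involution_iff _)
  rw [e, Nat.card_eq_fintype_card]
  clear e
  revert b
  decide

/-- For the group `S₄ × ℤ/2` (the group `⟨48, 48⟩` of the small groups library). -/
theorem mainTheorem7 :
    Nonempty (DisjointPair (Equiv.Perm (Fin 4) × Multiplicative (ZMod 2))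
      (fun _ : Fin 8 => 2) ![2, 4, 6]) ∧
    Nat.card (MulAction.orbitRel.Quotient
      (BraidGroup 8 × BraidGroup 3 × MulAut (Equiv.Perm (Fin 4) × Multiplicative (ZMod 2)))
      (DisjointPair (Equiv.Perm (Fin 4) × Multiplicative (ZMod 2))
        (fun _ : Fin 8 => 2) ![2, 4, 6])) = 2 := by
  refine ⟨⟨normalPair false⟩, Nat.card_eq_two_iff.mpr
    ⟨Quotient.mk _ (normalPair false), Quotient.mk _ (normalPair true), fun h => ?_, ?_⟩⟩
  · obtain ⟨g, hg⟩ := MulAction.orbitRel_apply.mp (Quotient.exact h)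
    have h1 : squareCount (normalPair false).1.1.1 = squareCount (normalPair true).1.1.1 := by
      rw [← hg]
      exact squareCount_smul g.2.2 g.1 (normalPair true).1.1
    have h2 := squareCount_normalWord false
    have h3 := squareCount_normalWord true
    exact absurd (h2.symm.trans (h1.trans h3)) (by decide)
  · refine Set.eq_univ_of_forall fun x => ?_
    induction x using Quotient.inductionOn with
    | h p =>
      obtain ⟨g, b, hb⟩ := exists_smul_eq_normalPair p
      have e : Quotient.mk (MulAction.orbitRel (BraidGroup 8 × BraidGroup 3 × MulAut S4C2) _) p =
          Quotient.mk _ (normalPair b) :=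
        Quotient.sound (MulAction.orbitRel_apply.mpr (MulAction.mem_orbit_symm.mp ⟨g, hb⟩))
      rw [e]
      cases b
      · exact .inl rfl
      · exact .inr rfl
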